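/- Fix $d\ge 1$ and $\boldsymbol\alpha=(\alpha_1,\dots,\alpha_d)$ with all $\alpha_i>0$. For $x>0$ and $v\in\mathbb R^d$ write $x^{\pm1/\boldsymbol\alpha}v=(x^{\pm1/\alpha_i}v_i)_i$, $\|v\|_{\boldsymbol\alpha}=\max_i|v_i|^{\alpha_i}$, and let $S=\{s\in\mathbb R^d:\|s\|_{\boldsymbol\alpha}=1\}$ (the max-norm unit sphere). *VSRV.* A random vector $X_0$ in $\mathbb R^d$ is VSRV of order $\boldsymbol\alpha$ if for each $i$ there is $a_i>0$ with $\mathbb P(|X_{0,i}|>x)\sim a_ix^{-\alpha_i}$ as $x\to\infty$, $\|X_0\|_{\boldsymbol\alpha}$ is regularly varying, and the law of $\|X_0\|_{\boldsymbol\alpha}^{-1/\boldsymbol\alpha}X_0$ given $\|X_0\|_{\boldsymbol\alpha}>x$ converges weakly to a probability measure as $x\to\infty$; a vector $\widetilde\Theta_0$ with the limit law is called a spectral component of $X_0$. A process $(X_t)_{t\ge0}$ is VSRV of order $\boldsymbol\alpha$ if $X_0$ satisfies these tail conditions and, for every $t\ge0$, the law of $\|X_0\|_{\boldsymbol\alpha}^{-1/\boldsymbol\alpha}(X_0,\dots,X_t)$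 given $\|X_0\|_{\boldsymbol\alpha}>x$ converges weakly to a probability measure as $x\to\infty$; a process $(\widetilde\Theta_t)_{t\ge0}$ such that, for every $t$, the limit is the law of $(\widetilde\Theta_0,\dots,\widetilde\Theta_t)$ is called a spectral tail process of $(X_t)$. (Stationarity is not required.) *VS condition.* Let $\mathcal E$ be a Polish space, $\Phi:\mathbb R^d\times\mathcal E\to\mathbb R^d$ measurable and $Z$ a random element of $\mathcal E$. $\Phi$ satisfies the vector-scaling condition with limit $\varphi$ if $\varphi:S\times\mathcal E\to\mathbb R^d$ is measurable and, for all $e\in\mathcal E$, $x^{-1/\boldsymbol\alpha}\Phi(x^{1/\boldsymbol\alpha}s(x),e)\to\varphi(s,e)$ as $x\to\infty$ whenever $s(x)\to s$ in $S$; and moreover, if $\mathbb P(\varphi(s,Z)=0)>0$ for some $s\in S$, then $Z\in\mathcal W$ a.s. for some $\mathcal W\subset\mathcal E$ such that $\sup_{\|y\|_{\boldsymbol\alpha}\le x}\|\Phi(y,e)\|_{\boldsymbol\alpha}=O(x)$ as $x\to\infty$ for all $e\in\mathcal W$. Extend $\varphi$ to $\mathbb R^d\times\mathcal E$ by $\varphi(v,e)=\|v\|_{\boldsymbol\alpha}^{1/\boldsymbol\alpha}\varphi(\|v\|_{\boldsymbol\alpha}^{-1/\boldsymbol\alpha}v,e)$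 for $v\ne0$ and $\varphi(0,e)=0$. **Theorem.** Let $(X_t)_{t\ge0}$ be a Markov chain in $\mathbb R^d$ with $X_t=\Phi(X_{t-1},Z_t)$ a.s. for $t\ge1$, where $(Z_t)_{t\ge1}$ is an iid sequence in $\mathcal E$ independent of $X_0$. Suppose that $\Phi$ satisfies the vector-scaling condition with limit $\varphi$ (with $Z$ distributed as $Z_1$), and that $X_0$ is VSRV of order $\boldsymbol\alpha$. Then $(X_t)_{t\ge0}$ is a VSRV process of order $\boldsymbol\alpha$, and its spectral tail process satisfies, in law, $$\widetilde\Theta_t=\varphi(\widetilde\Theta_{t-1},Z'_t),\qquad t\ge1,$$ started from the spectral component $\widetilde\Theta_0$ of $X_0$, where $(Z'_t)_{t\ge1}$ is an iid copy of $(Z_t)_{t\ge1}$ independent of $\widetilde\Theta_0$. That is: on some probability space there are such $\widetilde\Theta_0$ and $(Z'_t)$ for which this recursion defines a spectral tail process of $(X_t)$; and on every probability space, for every such $\widetilde\Theta_0$ and $(Z'_t)$, a process satisfying this recursion a.s. is a spectral tail process of $(X_t)$. -/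

import Mathlib

open MeasureTheory ProbabilityTheory Filter Topology BoundedContinuousFunction

universe u v w

noncomputable section

namespace VSRV

/-- The radial function `‖v‖_α = max_i |v_i| ^ α_i` on `ℝ^d`. -/
def anorm {d : ℕ} (α : Fin d → ℝ) (v : Fin d → ℝ) : ℝ := ⨆ i, |v i| ^ α i

/-- Vector scaling `x^{1/α} v = (x^{1/α_i} v_i)_i`. -/
def scaleUp {d : ℕ} (α : Fin d → ℝ) (x : ℝ) (v : Fin d → ℝ) : Fin d → ℝ :=
  fun i => x ^ (1 / α i) * v i

/-- Inverse vector scaling `x^{-1/α} v = (x^{-1/α_i} v_i)_i`. -/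
def scaleDown {d : ℕ} (α : Fin d → ℝ) (x : ℝ) (v : Fin d → ℝ) : Fin d → ℝ :=
  fun i => x ^ (-(1 / α i)) * v i

/-- The unit sphere `{s ∈ ℝ^d : ‖s‖_α = 1}` (for positive `α` it is the max-norm unit sphere). -/
abbrev Sphere {d : ℕ} (α : Fin d → ℝ) : Type := {s : Fin d → ℝ // anorm α s = 1}

theorem anorm_pos {d : ℕ} {α : Fin d → ℝ} {v : Fin d → ℝ} (hv : v ≠ 0) : 0 < anorm α v := by
  obtain ⟨i, hi⟩ := Function.ne_iff.mp hv
  have hi' : 0 < |v i| := abs_pos.mpr hi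
  exact (Real.rpow_pos_of_pos hi' _).trans_le
    (le_ciSup (f := fun i => |v i| ^ α i) (Set.finite_range _).bddAbove i)

/-- For `v ≠ 0` the vector `‖v‖_α^{-1/α} v` lies on the unit sphere. -/
theorem anorm_scaleDown {d : ℕ} {α : Fin d → ℝ} (hα : ∀ i, 0 < α i) {v : Fin d → ℝ}
    (hv : v ≠ 0) : anorm α (scaleDown α (anorm α v) v) = 1 := by
  have hr := anorm_pos (α := α) hv
  have key : ∀ i, |scaleDown α (anorm α v) v i| ^ α i = (anorm α v)⁻¹ * |v i| ^ α i := by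
    intro i
    have h1 : 0 ≤ anorm α v ^ (-(1 / α i)) := Real.rpow_nonneg hr.le _
    rw [scaleDown, abs_mul, abs_of_nonneg h1, Real.mul_rpow h1 (abs_nonneg _),
      ← Real.rpow_mul hr.le]
    have h2 : -(1 / α i) * α i = -1 := by
      have := (hα i).ne'
      field_simp
    rw [h2, Real.rpow_neg_one]
  have h3 : anorm α (scaleDown α (anorm α v) v) = (anorm α v)⁻¹ * anorm α v := by
    conv_lhs => rw [anorm]
    simp_rw [key]
    rw [← Real.mul_iSup_of_nonneg (inv_nonneg.mpr hr.le)]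
    rfl
  rw [h3, inv_mul_cancel₀ hr.ne']

open Classical in
/-- The extension of `φ : Sphere × E → ℝ^d` to `ℝ^d × E`:
`φ(v, e) = ‖v‖_α^{1/α} φ(‖v‖_α^{-1/α} v, e)` for `v ≠ 0` and `φ(0, e) = 0`. -/
def extend {d : ℕ} {E : Type*} {α : Fin d → ℝ} (hα : ∀ i, 0 < α i)
    (φ : Sphere α × E → Fin d → ℝ) (v : Fin d → ℝ) (e : E) : Fin d → ℝ :=
  if hv : v = 0 then 0
  else scaleUp α (anorm α v)
    (φ (⟨scaleDown α (anorm α v) v, anorm_scaleDown hα hv⟩, e))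

/-- The vector-scaling condition for `Φ`, with limit function `φ`, where `ρ` is the common law of
the innovations. The clause `‖Φ(y, e)‖_α ≤ C x` for all `‖y‖_α ≤ x` and all large `x` says that
`sup_{‖y‖_α ≤ x} ‖Φ(y, e)‖_α = O(x)` (in particular the supremum is finite). -/
structure VSCondition {d : ℕ} {E : Type*} [MeasurableSpace E] (α : Fin d → ℝ)
    (Φ : (Fin d → ℝ) × E → Fin d → ℝ) (ρ : Measure E) (φ : Sphere α × E → Fin d → ℝ) :
    Prop where
  measurable_limit : Measurable φ
  tendsto_limit : ∀ (e : E) (s : ℝ → Sphere α) (s₀ : Sphere α), Tendsto s atTop (𝓝 s₀) →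
    Tendsto (fun x : ℝ => scaleDown α x (Φ (scaleUp α x (s x).1, e))) atTop (𝓝 (φ (s₀, e)))
  growth : (∃ s : Sphere α, 0 < ρ {e | φ (s, e) = 0}) →
    ∃ W : Set E, (∀ᵐ e ∂ρ, e ∈ W) ∧
      ∀ e ∈ W, ∃ C x₀ : ℝ, ∀ x, x₀ ≤ x → ∀ y : Fin d → ℝ, anorm α y ≤ x →
        anorm α (Φ (y, e)) ≤ C * x

/-- A real random variable `R` has a regularly varying tail (with some index `κ > 0`). -/
def IsRegularlyVarying {Ω : Type*} [MeasurableSpace Ω] (μ : Measure Ω) (R : Ω → ℝ) : Prop :=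
  ∃ κ : ℝ, 0 < κ ∧ ∀ c : ℝ, 0 < c →
    Tendsto (fun x : ℝ => μ.real {ω | c * x < R ω} / μ.real {ω | x < R ω}) atTop (𝓝 (c ^ (-κ)))

/-- Weak convergence `m x → ν` as `x → ∞`, tested on bounded continuous functions. -/
def TendstoWeakly {S : Type*} [TopologicalSpace S] [MeasurableSpace S]
    (m : ℝ → Measure S) (ν : Measure S) : Prop :=
  ∀ f : S →ᵇ ℝ, Tendsto (fun x => ∫ y, f y ∂(m x)) atTop (𝓝 (∫ y, f y ∂ν))

/-- The tail conditions on `V = X₀`: `P(|V_i| > x) ∼ a_i x^{-α_i}` with `a_i > 0` for every `i`,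
and `‖V‖_α` is regularly varying. -/
structure TailConditions {d : ℕ} {Ω : Type*} [MeasurableSpace Ω] (α : Fin d → ℝ) (μ : Measure Ω)
    (V : Ω → Fin d → ℝ) : Prop where
  marginal : ∀ i, ∃ a : ℝ, 0 < a ∧
    Asymptotics.IsEquivalent atTop (fun x : ℝ => μ.real {ω | x < |V ω i|})
      (fun x : ℝ => a * x ^ (-α i))
  radial : IsRegularlyVarying μ (fun ω => anorm α (V ω))

/-- The law of `‖V‖_α^{-1/α} V` conditionally on `‖V‖_α > x`. -/
def condSpectralLaw {d : ℕ} {Ω : Type*} [MeasurableSpace Ω] (α : Fin d → ℝ) (μ : Measure Ω)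
    (V : Ω → Fin d → ℝ) (x : ℝ) : Measure (Fin d → ℝ) :=
  (μ[|{ω | x < anorm α (V ω)}]).map (fun ω => scaleDown α (anorm α (V ω)) (V ω))

/-- The law of `‖X₀‖_α^{-1/α} (X₀, …, X_t)` conditionally on `‖X₀‖_α > x`. -/
def condPathLaw {d : ℕ} {Ω : Type*} [MeasurableSpace Ω] (α : Fin d → ℝ) (μ : Measure Ω)
    (X : ℕ → Ω → Fin d → ℝ) (t : ℕ) (x : ℝ) : Measure (Fin (t + 1) → Fin d → ℝ) :=
  (μ[|{ω | x < anorm α (X 0 ω)}]).map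
    (fun ω (k : Fin (t + 1)) => scaleDown α (anorm α (X 0 ω)) (X k ω))

/-- The random vector `V` is VSRV of order `α`. -/
structure IsVSRVVector {d : ℕ} {Ω : Type*} [MeasurableSpace Ω] (α : Fin d → ℝ) (μ : Measure Ω)
    (V : Ω → Fin d → ℝ) : Prop where
  tails : TailConditions α μ V
  exists_limit : ∃ ν : Measure (Fin d → ℝ), IsProbabilityMeasure ν ∧
    TendstoWeakly (condSpectralLaw α μ V) ν

/-- The random vector `T`, defined on a space with probability `μ'`, is a spectral component
of `V`: its law is the weak limit of the law of `‖V‖_α^{-1/α} V` given `‖V‖_α > x`. -/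
def IsSpectralComponent {d : ℕ} {Ω Ω' : Type*} [MeasurableSpace Ω] [MeasurableSpace Ω']
    (α : Fin d → ℝ) (μ : Measure Ω) (V : Ω → Fin d → ℝ) (μ' : Measure Ω')
    (T : Ω' → Fin d → ℝ) : Prop :=
  Measurable T ∧ TendstoWeakly (condSpectralLaw α μ V) (μ'.map T)

/-- The process `(X_t)_{t ≥ 0}` is VSRV of order `α`: the tail conditions hold for `X₀` and, for
every `t ≥ 0`, the law of `‖X₀‖_α^{-1/α} (X₀, …, X_t)` given `‖X₀‖_α > x` converges weakly to a
probability measure. Only the limits are required, so that the notion makes sense for every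
process; a stationary VSRV time series is a stationary process with this property. -/
structure IsVSRV {d : ℕ} {Ω : Type*} [MeasurableSpace Ω] (α : Fin d → ℝ) (μ : Measure Ω)
    (X : ℕ → Ω → Fin d → ℝ) : Prop where
  tails : TailConditions α μ (X 0)
  exists_limit : ∀ t : ℕ, ∃ ν : Measure (Fin (t + 1) → Fin d → ℝ), IsProbabilityMeasure ν ∧
    TendstoWeakly (condPathLaw α μ X t) ν

/-- The process `(Θ_t)_{t ≥ 0}`, defined on a space with probability `μ'`, is a spectral tail
process of `(X_t)`. -/
def IsSpectralTailProcess {d : ℕ} {Ω Ω' : Type*} [MeasurableSpace Ω] [MeasurableSpace Ω']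
    (α : Fin d → ℝ) (μ : Measure Ω) (X : ℕ → Ω → Fin d → ℝ) (μ' : Measure Ω')
    (Θ : ℕ → Ω' → Fin d → ℝ) : Prop :=
  (∀ t, Measurable (Θ t)) ∧
    ∀ t : ℕ, TendstoWeakly (condPathLaw α μ X t)
      (μ'.map (fun ω (k : Fin (t + 1)) => Θ k ω))

/-- `(Y_t)_{t ≥ 0}` satisfies the recursion `Y_t = F(Y_{t-1}, Z_t)`, `t ≥ 1`, almost surely, where
`(Z_t)_{t ≥ 1}` is iid with law `ρ` and independent of `Y₀`. The value `Z 0` is not used. -/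
structure IsDrivenChain {d : ℕ} {Ω E : Type*} [MeasurableSpace Ω] [MeasurableSpace E]
    (F : (Fin d → ℝ) → E → Fin d → ℝ) (ρ : Measure E) (μ : Measure Ω)
    (Y : ℕ → Ω → Fin d → ℝ) (Z : ℕ → Ω → E) : Prop where
  measurable_state : ∀ t, Measurable (Y t)
  measurable_innov : ∀ t, Measurable (Z (t + 1))
  law_innov : ∀ t, μ.map (Z (t + 1)) = ρ
  indep_innov : iIndepFun (fun t => Z (t + 1)) μ
  indep_initial : IndepFun (Y 0) (fun ω t => Z (t + 1) ω) μ
  recursion : ∀ t, ∀ᵐ ω ∂μ, Y (t + 1) ω = F (Y t ω) (Z (t + 1) ω)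

end VSRV

end

noncomputable section

namespace VSRV

/-! ### The radial function and vector scaling -/

section Scaling

variable {d : ℕ} {α : Fin d → ℝ}

/-! Write `R = ‖X₀‖_α` and `S = R^{-1/α} X₀`. Scaling the path by `R` conjugates each step
(`scaleDown_path`): the scaled path starts at `S` and is driven by the maps `rescale α Φ R`. Given
`X₀`, the mean of `f` along it is therefore `G_R(S)`, where `G_r(s)` averages `f` over paths of
`rescale α Φ r` from `s`.

As `r → ∞` and `s' → s` jointly, these paths converge almost surely to the path of `extend hα φ`
from `s` (`tendsto_path_rescale`). A step from a nonzero limit state converges by the vector-scaling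
limit; a step from `0` needs the growth bound. One of the two always applies: either the growth
bound holds almost surely, or the limit path almost surely never reaches `0`. By dominated
convergence `G_r(s') → h(s)`, and compactness of the sphere makes `h` continuous and the convergence
uniform (`tendstoUniformly_integral_pathVec`).

Given `R > x` with `x` large, `G_R(S)` is thus uniformly close to `h(S)`, and the mean of `h(S)`
converges to that of `h(Θ₀)`, which is the mean of `f(Θ₀, …, Θ_t)`. -/

theorem rpow_abs_le_anorm (v : Fin d → ℝ) (i : Fin d) : |v i| ^ α i ≤ anorm α v :=
  le_ciSup (f := fun i => |v i| ^ α i) (Set.finite_range _).bddAbove i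

theorem anorm_nonneg (v : Fin d → ℝ) : 0 ≤ anorm α v :=
  Real.iSup_nonneg fun _ => Real.rpow_nonneg (abs_nonneg _) _

theorem anorm_zero (hα : ∀ i, 0 < α i) : anorm α (0 : Fin d → ℝ) = 0 := by
  simp [anorm, Real.zero_rpow (hα _).ne']

theorem ne_zero_of_anorm_pos (hα : ∀ i, 0 < α i) {v : Fin d → ℝ} (hv : 0 < anorm α v) :
    v ≠ 0 := by
  rintro rfl
  exact hv.ne' (anorm_zero hα)

theorem continuous_anorm (hα : ∀ i, 0 < α i) : Continuous (anorm α) := by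
  -- For `d = 0` the real supremum over the empty family is `0`, while `Finset.sup'` needs a
  -- nonempty index set.
  rcases isEmpty_or_nonempty (Fin d) with h | h
  · have : anorm α = fun _ => 0 := by
      ext v
      simp [anorm]
    rw [this]
    exact continuous_const
  · have : anorm α = fun v => Finset.univ.sup' Finset.univ_nonempty fun i => |v i| ^ α i := by
      ext v
      rw [Finset.sup'_univ_eq_ciSup, anorm]
    rw [this]
    refine Continuous.finset_sup'_apply _ fun i _ => ?_
    exact (continuous_apply i).abs.rpow_const fun _ => Or.inr (hα i).le

theorem anorm_scaleUp (hα : ∀ i, 0 < α i) {r : ℝ} (hr : 0 ≤ r) (v : Fin d → ℝ) :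
    anorm α (scaleUp α r v) = r * anorm α v := by
  have key : ∀ i, |scaleUp α r v i| ^ α i = r * |v i| ^ α i := by
    intro i
    have h1 : 0 ≤ r ^ (1 / α i) := Real.rpow_nonneg hr _
    rw [scaleUp, abs_mul, abs_of_nonneg h1, Real.mul_rpow h1 (abs_nonneg _), ← Real.rpow_mul hr,
      one_div_mul_cancel (hα i).ne', Real.rpow_one]
  rw [anorm]
  simp_rw [key]
  rw [← Real.mul_iSup_of_nonneg hr]
  rfl

/-- Reduces inverse scalings to `scaleUp`, whose exponents are positive when `α` is, so that it is
jointly continuous even at scale `0`. -/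
theorem scaleDown_eq_scaleUp_inv {r : ℝ} (hr : 0 ≤ r) (v : Fin d → ℝ) :
    scaleDown α r v = scaleUp α r⁻¹ v := by
  ext i
  rw [scaleDown, scaleUp, Real.inv_rpow hr, Real.rpow_neg hr]

theorem scaleUp_scaleUp {r s : ℝ} (hr : 0 ≤ r) (hs : 0 ≤ s) (v : Fin d → ℝ) :
    scaleUp α r (scaleUp α s v) = scaleUp α (r * s) v := by
  ext i
  simp only [scaleUp]
  rw [Real.mul_rpow hr hs, mul_assoc]

theorem scaleUp_one (v : Fin d → ℝ) : scaleUp α 1 v = v := by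
  ext i
  simp [scaleUp]

theorem scaleUp_scaleDown {r : ℝ} (hr : 0 < r) (v : Fin d → ℝ) :
    scaleUp α r (scaleDown α r v) = v := by
  rw [scaleDown_eq_scaleUp_inv hr.le, scaleUp_scaleUp hr.le (inv_nonneg.2 hr.le),
    mul_inv_cancel₀ hr.ne', scaleUp_one]

theorem continuous_scaleUp (hα : ∀ i, 0 < α i) :
    Continuous fun p : ℝ × (Fin d → ℝ) => scaleUp α p.1 p.2 := by
  refine continuous_pi fun i => ?_
  refine (continuous_fst.rpow_const fun _ => Or.inr ?_).mul
    ((continuous_apply i).comp continuous_snd)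
  exact (one_div_pos.2 (hα i)).le

theorem measurable_scaleDown :
    Measurable fun p : ℝ × (Fin d → ℝ) => scaleDown α p.1 p.2 := by
  refine measurable_pi_lambda _ fun i => ?_
  exact (measurable_fst.pow_const _).mul ((measurable_pi_apply i).comp measurable_snd)

theorem tendsto_scaleDown_anorm (hα : ∀ i, 0 < α i) {y : Fin d → ℝ} (hy : y ≠ 0) :
    Tendsto (fun v => scaleDown α (anorm α v) v) (𝓝 y) (𝓝 (scaleDown α (anorm α y) y)) := by
  simp_rw [scaleDown_eq_scaleUp_inv (anorm_nonneg _)]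
  have h1 : Tendsto (fun v => ((anorm α v)⁻¹, v)) (𝓝 y) (𝓝 ((anorm α y)⁻¹, y)) :=
    (((continuous_anorm hα).tendsto y).inv₀ (anorm_pos hy).ne').prodMk_nhds tendsto_id
  exact ((continuous_scaleUp hα).tendsto _).comp h1

/-- `anorm α` need not be a norm, so the argument is coordinatewise: squeeze `|f_i|^{α_i}`, then
undo the power. -/
theorem tendsto_zero_of_anorm (hα : ∀ i, 0 < α i) {ι : Type*} {l : Filter ι}
    {f : ι → Fin d → ℝ} (h : Tendsto (fun x => anorm α (f x)) l (𝓝 0)) :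
    Tendsto f l (𝓝 0) := by
  refine tendsto_pi_nhds.2 fun i => ?_
  have h1 : Tendsto (fun x => |f x i| ^ α i) l (𝓝 0) :=
    squeeze_zero (fun _ => Real.rpow_nonneg (abs_nonneg _) _)
      (fun x => rpow_abs_le_anorm (f x) i) h
  have h2 := h1.rpow_const (p := (α i)⁻¹) (Or.inr (inv_pos.2 (hα i)).le)
  rw [Real.zero_rpow (inv_pos.2 (hα i)).ne'] at h2
  simp_rw [Real.rpow_rpow_inv (abs_nonneg _) (hα i).ne'] at h2
  exact (tendsto_zero_iff_abs_tendsto_zero _).2 h2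

theorem compactSpace_sphere (hα : ∀ i, 0 < α i) : CompactSpace (Sphere α) := by
  suffices h : IsCompact {s : Fin d → ℝ | anorm α s = 1} from isCompact_iff_compactSpace.1 h
  refine (isCompact_Icc (a := (-1 : Fin d → ℝ)) (b := 1)).of_isClosed_subset
    (isClosed_eq (continuous_anorm hα) continuous_const) fun v hv => ?_
  have h : ∀ i, |v i| ≤ 1 := by
    intro i
    by_contra! hi
    exact (Real.one_lt_rpow hi (hα i)).not_ge ((rpow_abs_le_anorm v i).trans_eq hv)
  exact ⟨fun i => (abs_le.1 (h i)).1, fun i => (abs_le.1 (h i)).2⟩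

/-- The direction `‖v‖_α^{-1/α} v` of a vector `v ≠ 0`, as a point of the unit sphere. -/
def direction (hα : ∀ i, 0 < α i) (v : {v : Fin d → ℝ // v ≠ 0}) : Sphere α :=
  ⟨scaleDown α (anorm α v.1) v.1, anorm_scaleDown hα v.2⟩

theorem extend_of_ne_zero {E : Type*} (hα : ∀ i, 0 < α i) (φ : Sphere α × E → Fin d → ℝ)
    {v : Fin d → ℝ} (hv : v ≠ 0) (e : E) :
    extend hα φ v e = scaleUp α (anorm α v) (φ (direction hα ⟨v, hv⟩, e)) := by
  rw [extend, dif_neg hv, direction]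

theorem extend_zero {E : Type*} (hα : ∀ i, 0 < α i) (φ : Sphere α × E → Fin d → ℝ) (e : E) :
    extend hα φ 0 e = 0 := by
  rw [extend, dif_pos rfl]

/-- Scaling by a positive radius is injective. This ties hitting `0` to the event in the `growth`
clause. -/
theorem extend_eq_zero_iff {E : Type*} (hα : ∀ i, 0 < α i) (φ : Sphere α × E → Fin d → ℝ)
    {v : Fin d → ℝ} (hv : v ≠ 0) (e : E) :
    extend hα φ v e = 0 ↔ φ (direction hα ⟨v, hv⟩, e) = 0 := by
  rw [extend_of_ne_zero hα φ hv]
  refine ⟨fun h => ?_, fun h => ?_⟩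
  · ext i
    have := congrFun h i
    simpa [scaleUp, (Real.rpow_pos_of_pos (anorm_pos (α := α) hv) _).ne'] using this
  · ext i
    simp [scaleUp, h]

theorem measurable_extend {E : Type*} [MeasurableSpace E] (hα : ∀ i, 0 < α i)
    {φ : Sphere α × E → Fin d → ℝ} (hφ : Measurable φ) :
    Measurable fun p : (Fin d → ℝ) × E => extend hα φ p.1 p.2 := by
  have hs : MeasurableSet {p : (Fin d → ℝ) × E | p.1 = 0} :=
    (measurableSet_singleton (0 : Fin d → ℝ)).preimage measurable_fst
  refine measurable_of_restrict_of_restrict_compl hs ?_ ?_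
  · have : ({p : (Fin d → ℝ) × E | p.1 = 0}).domRestrict
        (fun p : (Fin d → ℝ) × E => extend hα φ p.1 p.2) = fun _ => 0 := by
      ext1 ⟨p, hp⟩
      have hp' : p.1 = 0 := hp
      rw [Set.domRestrict_apply, hp', extend_zero]
    rw [this]
    exact measurable_const
  · have : ({p : (Fin d → ℝ) × E | p.1 = 0}ᶜ).domRestrict
        (fun p : (Fin d → ℝ) × E => extend hα φ p.1 p.2) = fun p =>
          scaleUp α (anorm α p.1.1) (φ (direction hα ⟨p.1.1, p.2⟩, p.1.2)) := by
      ext1 ⟨p, hp⟩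
      exact extend_of_ne_zero hα φ hp _
    rw [this]
    have ha := (continuous_anorm hα).measurable
    have h1 : Measurable fun p : ↥({p : (Fin d → ℝ) × E | p.1 = 0}ᶜ) => p.1.1 :=
      measurable_fst.comp measurable_subtype_coe
    have hd : Measurable fun p : ↥({p : (Fin d → ℝ) × E | p.1 = 0}ᶜ) =>
        direction hα ⟨p.1.1, p.2⟩ :=
      (measurable_scaleDown.comp ((ha.comp h1).prodMk h1)).subtype_mk
    exact (continuous_scaleUp hα).measurable.comp ((ha.comp h1).prodMk
      (hφ.comp (hd.prodMk (measurable_snd.comp measurable_subtype_coe))))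

end Scaling

/-! ### Convergence of the rescaled maps -/

/-- Joint convergence at infinity, from convergence along every function `s(x) → s₀`. -/
theorem tendsto_atTop_prod_nhds_of_forall {S T : Type*} [TopologicalSpace S]
    [FirstCountableTopology S] [TopologicalSpace T] {F : ℝ → S → T} {s₀ : S} {c : T}
    (h : ∀ s : ℝ → S, Tendsto s atTop (𝓝 s₀) → Tendsto (fun x => F x (s x)) atTop (𝓝 c)) :
    Tendsto (fun p : ℝ × S => F p.1 p.2) (atTop ×ˢ 𝓝 s₀) (𝓝 c) := by
  by_contra hcon
  rw [Filter.tendsto_def] at hcon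
  push Not at hcon
  obtain ⟨U, hU, hUn⟩ := hcon
  have hfr : ∃ᶠ p : ℝ × S in atTop ×ˢ 𝓝 s₀, F p.1 p.2 ∉ U := fun hev => hUn (by
    filter_upwards [hev] with p hp
    simpa using hp)
  obtain ⟨q, hq, hqU⟩ := exists_seq_forall_of_frequently hfr
  obtain ⟨hq1, hq2⟩ := tendsto_prod_iff'.1 hq
  -- Strictly increasing scales make the bad sequence the restriction of a function `s` of a real
  -- variable, set equal to `s₀` at all other scales.
  obtain ⟨k, hk, hmono⟩ := strictMono_subseq_of_tendsto_atTop hq1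
  set x : ℕ → ℝ := (fun n => (q n).1) ∘ k with hx
  have hxt : Tendsto x atTop atTop := hq1.comp hk.tendsto_atTop
  set s : ℝ → S := Function.extend x (fun n => (q (k n)).2) fun _ => s₀ with hs
  have hst : Tendsto s atTop (𝓝 s₀) := by
    rw [Filter.tendsto_def]
    intro V hV
    obtain ⟨N, hN⟩ := eventually_atTop.1 ((hq2.comp hk.tendsto_atTop).eventually hV)
    filter_upwards [eventually_ge_atTop (x N)] with y hy
    by_cases hyx : ∃ n, x n = y
    · obtain ⟨n, rfl⟩ := hyx
      rw [Set.mem_preimage, hs, hmono.injective.extend_apply]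
      exact hN n (hmono.le_iff_le.1 hy)
    · rw [Set.mem_preimage, hs, Function.extend_apply' _ _ _ hyx]
      exact mem_of_mem_nhds hV
  obtain ⟨n, hn⟩ := (((h s hst).comp hxt).eventually hU).exists
  simp only [Function.comp_apply] at hn
  rw [hs, hmono.injective.extend_apply] at hn
  exact hqU (k n) hn

section Rescale

variable {d : ℕ} {α : Fin d → ℝ} {E : Type*}

/-- The rescaled map `(y, e) ↦ r^{-1/α} Φ(r^{1/α} y, e)`. -/
def rescale (α : Fin d → ℝ) (Φ : (Fin d → ℝ) × E → Fin d → ℝ) (r : ℝ) (y : Fin d → ℝ) (e : E) :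
    Fin d → ℝ :=
  scaleDown α r (Φ (scaleUp α r y, e))

/-- `‖Φ(y, e)‖_α = O(x)` uniformly over `‖y‖_α ≤ x`. -/
def LinearGrowth (α : Fin d → ℝ) (Φ : (Fin d → ℝ) × E → Fin d → ℝ) (e : E) : Prop :=
  ∃ C x₀ : ℝ, ∀ x, x₀ ≤ x → ∀ y : Fin d → ℝ, anorm α y ≤ x → anorm α (Φ (y, e)) ≤ C * x

/-- Polar coordinates: if `y'` has radius `R` and direction `s`, the rescaled map at scale `r` is
`R^{1/α}` applied to the quotient of the vector-scaling condition at `s` and scale `r R`. As `y' → y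
≠ 0`, still `r R → ∞`. -/
theorem tendsto_rescale_of_ne_zero [MeasurableSpace E] (hα : ∀ i, 0 < α i)
    {Φ : (Fin d → ℝ) × E → Fin d → ℝ} {ρ : Measure E} {φ : Sphere α × E → Fin d → ℝ}
    (hVS : VSCondition α Φ ρ φ) (e : E) {y : Fin d → ℝ} (hy : y ≠ 0) :
    Tendsto (fun p : ℝ × (Fin d → ℝ) => rescale α Φ p.1 p.2 e) (atTop ×ˢ 𝓝 y)
      (𝓝 (extend hα φ y e)) := by
  rw [extend_of_ne_zero hα φ hy]
  have hlim := tendsto_atTop_prod_nhds_of_forall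
    (F := fun x (s : Sphere α) => scaleDown α x (Φ (scaleUp α x s.1, e)))
    (hVS.tendsto_limit e · (direction hα ⟨y, hy⟩))
  have hpos := anorm_pos (α := α) hy
  have ha : Tendsto (fun p : ℝ × (Fin d → ℝ) => anorm α p.2) (atTop ×ˢ 𝓝 y)
      (𝓝 (anorm α y)) := ((continuous_anorm hα).tendsto y).comp tendsto_snd
  have hne : ∀ᶠ p : ℝ × (Fin d → ℝ) in atTop ×ˢ 𝓝 y, 0 < p.1 ∧ p.2 ≠ 0 :=
    (eventually_gt_atTop 0).prod_mk (isOpen_ne.eventually_mem hy)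
  classical
  -- The value at `v = 0` is arbitrary: only `v` near `y ≠ 0` matter.
  let s : (Fin d → ℝ) → Sphere α := fun v =>
    if hv : v ≠ 0 then direction hα ⟨v, hv⟩ else direction hα ⟨y, hy⟩
  have hs : Tendsto s (𝓝 y) (𝓝 (direction hα ⟨y, hy⟩)) := by
    rw [tendsto_subtype_rng]
    refine (tendsto_scaleDown_anorm hα hy).congr' ?_
    filter_upwards [isOpen_ne.eventually_mem hy] with v hv
    have hv' : v ≠ 0 := hv
    simp only [s, dif_pos hv', direction]
  have hin : Tendsto (fun p : ℝ × (Fin d → ℝ) => (p.1 * anorm α p.2, s p.2)) (atTop ×ˢ 𝓝 y)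
      (atTop ×ˢ 𝓝 (direction hα ⟨y, hy⟩)) :=
    (tendsto_fst.atTop_mul_pos hpos ha).prodMk (hs.comp tendsto_snd)
  have hcomb := ((continuous_scaleUp hα).tendsto _).comp (ha.prodMk_nhds (hlim.comp hin))
  refine hcomb.congr' ?_
  filter_upwards [hne] with p hp
  obtain ⟨hp1, hp2⟩ := hp
  have hp3 := anorm_pos (α := α) hp2
  have hmul := mul_pos hp1 hp3
  have e1 : scaleUp α (p.1 * anorm α p.2) (scaleDown α (anorm α p.2) p.2)
      = scaleUp α p.1 p.2 := by
    rw [← scaleUp_scaleUp hp1.le hp3.le, scaleUp_scaleDown hp3]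
  simp only [Function.comp_apply, s, dif_pos hp2, direction, e1, rescale]
  rw [scaleDown_eq_scaleUp_inv hmul.le, scaleUp_scaleUp hp3.le (inv_nonneg.2 hmul.le),
    scaleDown_eq_scaleUp_inv hp1.le]
  congr 1
  field_simp

/-- Linear growth at level `max (r ‖y‖_α) (max x₀ 0)`, divided by `r`, gives the bound `|C| max
(‖y‖_α) (max x₀ 0 / r)`. The inner `max` with `0` keeps the level nonnegative, so that `C` may be
replaced by `|C|`. -/
theorem tendsto_rescale_zero (hα : ∀ i, 0 < α i) {Φ : (Fin d → ℝ) × E → Fin d → ℝ} {e : E}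
    (he : LinearGrowth α Φ e) :
    Tendsto (fun p : ℝ × (Fin d → ℝ) => rescale α Φ p.1 p.2 e) (atTop ×ˢ 𝓝 0) (𝓝 0) := by
  obtain ⟨C, x₀, hC⟩ := he
  refine tendsto_zero_of_anorm hα ?_
  have h1 : Tendsto (fun p : ℝ × (Fin d → ℝ) => |C| * max (anorm α p.2) (max x₀ 0 / p.1))
      (atTop ×ˢ 𝓝 0) (𝓝 0) := by
    have ha : Tendsto (fun p : ℝ × (Fin d → ℝ) => anorm α p.2) (atTop ×ˢ 𝓝 0) (𝓝 0) := by
      have := ((continuous_anorm hα).tendsto 0).comp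
        (tendsto_snd : Tendsto (Prod.snd : ℝ × (Fin d → ℝ) → _) (atTop ×ˢ 𝓝 0) (𝓝 0))
      rwa [anorm_zero hα] at this
    have hb : Tendsto (fun p : ℝ × (Fin d → ℝ) => max x₀ 0 / p.1) (atTop ×ˢ 𝓝 0) (𝓝 0) :=
      tendsto_fst.const_div_atTop _
    simpa using (ha.max hb).const_mul |C|
  refine squeeze_zero' (.of_forall fun _ => anorm_nonneg _) ?_ h1
  filter_upwards [(eventually_gt_atTop (0 : ℝ)).prod_inl (𝓝 (0 : Fin d → ℝ))] with p hp
  have hx0 : 0 ≤ max (p.1 * anorm α p.2) (max x₀ 0) := le_max_of_le_right (le_max_right _ _)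
  have h2 := hC (max (p.1 * anorm α p.2) (max x₀ 0))
    (le_max_of_le_right (le_max_left _ _)) (scaleUp α p.1 p.2)
    ((anorm_scaleUp hα hp.le _).le.trans (le_max_left _ _))
  rw [rescale, scaleDown_eq_scaleUp_inv hp.le, anorm_scaleUp hα (inv_nonneg.2 hp.le)]
  calc p.1⁻¹ * anorm α (Φ (scaleUp α p.1 p.2, e))
      ≤ p.1⁻¹ * (|C| * max (p.1 * anorm α p.2) (max x₀ 0)) := by
        gcongr
        exact h2.trans (mul_le_mul_of_nonneg_right (le_abs_self C) hx0)
    _ = |C| * max (anorm α p.2) (max x₀ 0 / p.1) := by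
        rw [mul_left_comm, mul_max_of_nonneg _ _ (inv_nonneg.2 hp.le),
          inv_mul_cancel_left₀ hp.ne', div_eq_inv_mul]

end Rescale

/-! ### Paths of the recursion -/

section Path

variable {V E : Type*}

/-- The path of the recursion `y_{k+1} = F(y_k, z_k)` started from `v`. -/
def path (F : V → E → V) (v : V) (z : ℕ → E) : ℕ → V
  | 0 => v
  | k + 1 => F (path F v z k) (z k)

/-- Peels off the first step instead of the last, so that `ae_path_ne` can integrate over the first
innovation separately. -/
theorem path_succ' (F : V → E → V) (v : V) (z : ℕ → E) (k : ℕ) :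
    path F v z (k + 1) = path F (F v (z 0)) (fun n => z (n + 1)) k := by
  induction k with
  | zero => rfl
  | succ k ih => rw [path, ih, path]

theorem measurable_path [MeasurableSpace V] [MeasurableSpace E] {F : V → E → V}
    (hF : Measurable fun p : V × E => F p.1 p.2) (k : ℕ) :
    Measurable fun p : V × (ℕ → E) => path F p.1 p.2 k := by
  induction k with
  | zero => exact measurable_fst
  | succ k ih =>
    exact hF.comp (ih.prodMk ((measurable_pi_apply k).comp measurable_snd))

variable {d : ℕ} {α : Fin d → ℝ}

/-- Between consecutive conjugated steps the scalings up and down cancel. -/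
theorem scaleDown_path {Φ : (Fin d → ℝ) × E → Fin d → ℝ} {r : ℝ} (hr : 0 < r)
    (v : Fin d → ℝ) (z : ℕ → E) (k : ℕ) :
    scaleDown α r (path (fun y e => Φ (y, e)) v z k)
      = path (rescale α Φ r) (scaleDown α r v) z k := by
  induction k with
  | zero => rfl
  | succ k ih => rw [path, path, ← ih, rescale, scaleUp_scaleDown hr]

/-- Joint convergence in scale and state composes, because each step is evaluated at a moving point.
Pointwise convergence of the maps would not suffice. -/
theorem tendsto_path_rescale [MeasurableSpace E] (hα : ∀ i, 0 < α i)
    {Φ : (Fin d → ℝ) × E → Fin d → ℝ} {ρ : Measure E} {φ : Sphere α × E → Fin d → ℝ}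
    (hVS : VSCondition α Φ ρ φ) {v : Fin d → ℝ} {z : ℕ → E}
    (hz : ∀ k, path (extend hα φ) v z k ≠ 0 ∨ LinearGrowth α Φ (z k)) (k : ℕ) :
    Tendsto (fun p : ℝ × (Fin d → ℝ) => path (rescale α Φ p.1) p.2 z k) (atTop ×ˢ 𝓝 v)
      (𝓝 (path (extend hα φ) v z k)) := by
  induction k with
  | zero => exact tendsto_snd
  | succ k ih =>
    have hstep : Tendsto (fun p : ℝ × (Fin d → ℝ) => rescale α Φ p.1 p.2 (z k))
        (atTop ×ˢ 𝓝 (path (extend hα φ) v z k))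
        (𝓝 (extend hα φ (path (extend hα φ) v z k) (z k))) := by
      by_cases h0 : path (extend hα φ) v z k = 0
      · rw [h0, extend_zero]
        exact tendsto_rescale_zero hα ((hz k).resolve_left (not_not.2 h0))
      · exact tendsto_rescale_of_ne_zero hα hVS (z k) h0
    exact hstep.comp (tendsto_fst.prodMk ih)

end Path

/-! ### Infinite product laws -/

section Product

variable {E : Type*} [MeasurableSpace E]

/-- The law of an iid sequence splits into the law of its first term and that of its tail. -/
theorem map_infinitePi_head_tail (ρ : Measure E) [IsProbabilityMeasure ρ] :
    (ρ.prod (Measure.infinitePi fun _ : ℕ => ρ)).map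
        (fun p n => Nat.casesOn n p.1 p.2 : E × (ℕ → E) → ℕ → E)
      = Measure.infinitePi fun _ : ℕ => ρ := by
  have hm : Measurable (fun p n => Nat.casesOn n p.1 p.2 : E × (ℕ → E) → ℕ → E) := by
    refine measurable_pi_lambda _ fun n => ?_
    cases n with
    | zero => exact measurable_fst
    | succ n => exact (measurable_pi_apply n).comp measurable_snd
  refine Measure.eq_infinitePi _ fun s t ht => ?_
  classical
  -- Padding with `Set.univ` turns the cylinder into one over an initial segment of indices, whose
  -- factor at `0` splits off.
  set u : ℕ → Set E := fun i => if i ∈ s then t i else Set.univ with hu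
  have hum : ∀ i, MeasurableSet (u i) := by
    intro i
    simp only [hu]
    split_ifs
    · exact ht i
    · exact .univ
  obtain ⟨N, hN⟩ := s.exists_nat_subset_range
  have hset : Set.pi (s : Set ℕ) t = Set.pi (Finset.range (N + 1) : Set ℕ) u := by
    ext z
    simp only [Set.mem_pi, hu, Finset.mem_coe]
    refine ⟨fun h i _ => ?_, fun h i hi => ?_⟩
    · split_ifs with his
      · exact h i his
      · trivial
    · have := h i (Finset.mem_range.2 ((Finset.mem_range.1 (hN hi)).trans N.lt_succ_self))
      rwa [if_pos hi] at this
  have hprod : ∏ i ∈ s, ρ (t i) = ∏ i ∈ Finset.range (N + 1), ρ (u i) := by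
    rw [← Finset.prod_subset (s₁ := s)
      (hN.trans (Finset.range_mono N.le_succ)) fun i _ hi => by simp [hu, hi]]
    exact Finset.prod_congr rfl fun i hi => by simp [hu, hi]
  rw [hprod, hset, Measure.map_apply hm (.pi (Finset.countable_toSet _) fun i _ => hum i),
    Finset.prod_range_succ', mul_comm]
  have hpre : (fun p n => Nat.casesOn n p.1 p.2 : E × (ℕ → E) → ℕ → E) ⁻¹'
        Set.pi (Finset.range (N + 1) : Set ℕ) u
      = u 0 ×ˢ Set.pi (Finset.range N : Set ℕ) fun i => u (i + 1) := by
    ext p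
    simp only [Set.mem_preimage, Set.mem_pi, Finset.mem_coe, Finset.mem_range, Set.mem_prod]
    refine ⟨fun h => ⟨h 0 N.succ_pos, fun i hi => h (i + 1) (Nat.succ_lt_succ hi)⟩, ?_⟩
    rintro ⟨h0, h1⟩ (_ | i) hi
    · exact h0
    · exact h1 i (Nat.lt_of_succ_lt_succ hi)
  rw [hpre, Measure.prod_prod, Measure.infinitePi_pi _ fun i _ => hum (i + 1)]

theorem ae_infinitePi_forall {ρ : Measure E} [IsProbabilityMeasure ρ] {p : E → Prop}
    (h : ∀ᵐ e ∂ρ, p e) : ∀ᵐ z ∂Measure.infinitePi fun _ : ℕ => ρ, ∀ k, p (z k) :=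
  ae_all_iff.2 fun k =>
    (measurePreserving_eval_infinitePi (fun _ : ℕ => ρ) k).quasiMeasurePreserving.ae h

/-- A path whose steps almost surely avoid a point almost surely never visits it. -/
theorem ae_path_ne {V : Type*} [MeasurableSpace V] [MeasurableSingletonClass V]
    {ρ : Measure E} [IsProbabilityMeasure ρ] {F : V → E → V}
    (hF : Measurable fun p : V × E => F p.1 p.2) {c : V}
    (h : ∀ v, v ≠ c → ∀ᵐ e ∂ρ, F v e ≠ c) (k : ℕ) (v : V) (hv : v ≠ c) :
    ∀ᵐ z ∂Measure.infinitePi fun _ : ℕ => ρ, path F v z k ≠ c := by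
  induction k generalizing v with
  | zero => exact .of_forall fun _ => hv
  | succ k ih =>
    have hm : Measurable (fun p n => Nat.casesOn n p.1 p.2 : E × (ℕ → E) → ℕ → E) := by
      refine measurable_pi_lambda _ fun n => ?_
      cases n with
      | zero => exact measurable_fst
      | succ n => exact (measurable_pi_apply n).comp measurable_snd
    have hs : ∀ w j, MeasurableSet {z : ℕ → E | path F w z j ≠ c} := fun w j =>
      ((measurable_path hF j).comp measurable_prodMk_left (measurableSet_singleton c)).compl
    -- By Fubini, the first step almost surely lands off `c`, and the induction hypothesis applies
    -- from there; hence the generalization over `v`.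
    rw [← map_infinitePi_head_tail, ae_map_iff hm.aemeasurable (hs v (k + 1))]
    simp_rw [path_succ']
    have hF' : Measurable fun p : E × (ℕ → E) => path F (F v p.1) p.2 k :=
      (measurable_path hF k).comp
        ((hF.comp (measurable_const.prodMk measurable_fst)).prodMk measurable_snd)
    refine (Measure.ae_prod_iff_ae_ae (hF' (measurableSet_singleton c)).compl).2 ?_
    filter_upwards [h v hv] with e he
    exact ih _ he

variable {V : Type*} [MeasurableSpace V] {Ω : Type*} [MeasurableSpace Ω]

/-- Conditionally on an event that depends on `Y`, a random element independent of `Y` can be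
integrated out. -/
theorem integral_cond_of_indepFun {μ : Measure Ω} [IsProbabilityMeasure μ]
    {Y : Ω → V} {Z : Ω → E} (hY : Measurable Y) (hZ : Measurable Z) (hind : IndepFun Y Z μ)
    {B : Set V} (hB : MeasurableSet B) {F : V × E → ℝ} (hF : Measurable F)
    {C : ℝ} (hC : ∀ p, |F p| ≤ C) :
    ∫ ω, F (Y ω, Z ω) ∂(μ[|Y ⁻¹' B]) = ∫ ω, (∫ z, F (Y ω, z) ∂(μ.map Z)) ∂(μ[|Y ⁻¹' B]) := by
  -- The event constrains only the first coordinate, so restricting to it keeps the joint law a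
  -- product.
  have hmap : (μ.restrict (Y ⁻¹' B)).map (fun ω => (Y ω, Z ω))
      = ((μ.restrict (Y ⁻¹' B)).map Y).prod (μ.map Z) := by
    rw [← Measure.restrict_map hY hB]
    have : Y ⁻¹' B = (fun ω => (Y ω, Z ω)) ⁻¹' (B ×ˢ Set.univ) := by ext; simp
    rw [this, ← Measure.restrict_map (hY.prodMk hZ) (hB.prod .univ),
      (indepFun_iff_map_prod_eq_prod_map_map hY.aemeasurable hZ.aemeasurable).1 hind,
      ← Measure.prod_restrict, Measure.restrict_univ]
  have : IsProbabilityMeasure (μ.map Z) := Measure.isProbabilityMeasure_map hZ.aemeasurable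
  rw [ProbabilityTheory.cond, integral_smul_measure, integral_smul_measure]
  congr 1
  rw [← integral_map (φ := fun ω => (Y ω, Z ω)) (hY.prodMk hZ).aemeasurable
      hF.aestronglyMeasurable, hmap, integral_prod]
  · exact integral_map hY.aemeasurable
      hF.stronglyMeasurable.integral_prod_right'.aestronglyMeasurable
  · exact .of_bound hF.aestronglyMeasurable C (.of_forall hC)

end Product

/-! ### Convergence of the conditional expectations -/

section Limit

variable {d : ℕ} {α : Fin d → ℝ} {E : Type*} [MeasurableSpace E]

/-- The vector `(y_0, …, y_t)` of the first states of the path started from `v`. -/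
def pathVec {V : Type*} (F : V → E → V) (t : ℕ) (v : V) (z : ℕ → E) : Fin (t + 1) → V :=
  fun k => path F v z k

theorem measurable_pathVec {V : Type*} [MeasurableSpace V] {F : V → E → V}
    (hF : Measurable fun p : V × E => F p.1 p.2) (t : ℕ) :
    Measurable fun p : V × (ℕ → E) => pathVec F t p.1 p.2 :=
  measurable_pi_lambda _ fun k => measurable_path hF k

theorem measurable_comp_pathVec {F : (Fin d → ℝ) → E → Fin d → ℝ}
    (hF : Measurable fun p : (Fin d → ℝ) × E => F p.1 p.2) {t : ℕ}
    (f : (Fin (t + 1) → Fin d → ℝ) →ᵇ ℝ) :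
    Measurable fun p : (Fin d → ℝ) × (ℕ → E) => f (pathVec F t p.1 p.2) :=
  f.continuous.measurable.comp (measurable_pathVec hF t)

theorem measurable_rescale {Φ : (Fin d → ℝ) × E → Fin d → ℝ} (hΦ : Measurable Φ)
    (hα : ∀ i, 0 < α i) (r : ℝ) :
    Measurable fun p : (Fin d → ℝ) × E => rescale α Φ r p.1 p.2 :=
  measurable_scaleDown.comp (measurable_const.prodMk (hΦ.comp
    (((continuous_scaleUp hα).measurable.comp (measurable_const.prodMk measurable_fst)).prodMk
      measurable_snd)))

/-- For fixed `v ≠ 0`, almost every path from `v` satisfies the alternative under which the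
rescaled paths converge. -/
theorem ae_path_ne_zero_or_linearGrowth (hα : ∀ i, 0 < α i) {Φ : (Fin d → ℝ) × E → Fin d → ℝ}
    {ρ : Measure E} [IsProbabilityMeasure ρ] {φ : Sphere α × E → Fin d → ℝ}
    (hVS : VSCondition α Φ ρ φ) {v : Fin d → ℝ} (hv : v ≠ 0) :
    ∀ᵐ z ∂Measure.infinitePi fun _ : ℕ => ρ,
      ∀ k, path (extend hα φ) v z k ≠ 0 ∨ LinearGrowth α Φ (z k) := by
  by_cases h : ∃ s : Sphere α, 0 < ρ {e | φ (s, e) = 0}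
  · obtain ⟨W, hW, hWg⟩ := hVS.growth h
    filter_upwards [ae_infinitePi_forall hW] with z hz k
    exact Or.inr (hWg _ (hz k))
  · push Not at h
    have hne : ∀ w : Fin d → ℝ, w ≠ 0 → ∀ᵐ e ∂ρ, extend hα φ w e ≠ 0 := by
      intro w hw
      have h0 := le_antisymm (h (direction hα ⟨w, hw⟩)) (zero_le)
      rw [ae_iff]
      simpa only [ne_eq, not_not, extend_eq_zero_iff hα φ hw] using h0
    filter_upwards [ae_all_iff.2 fun k =>
      ae_path_ne (measurable_extend hα hVS.measurable_limit) hne k v hv] with z hz k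
    exact Or.inl (hz k)

/-- On a compact space, continuous convergence is uniform and has a continuous limit. -/
theorem continuous_and_tendstoUniformly_of_tendsto_prod {S M : Type*} [TopologicalSpace S]
    [CompactSpace S] [PseudoMetricSpace M] {G : ℝ → S → M} {h : S → M}
    (hlim : ∀ s, Tendsto (fun p : ℝ × S => G p.1 p.2) (atTop ×ˢ 𝓝 s) (𝓝 (h s))) :
    Continuous h ∧ TendstoUniformly G h atTop := by
  have hcont : Continuous h := by
    refine continuous_iff_continuousAt.2 fun s => Metric.tendsto_nhds.2 fun ε hε => ?_
    obtain ⟨p, hp, q, hq, hpq⟩ := eventually_prod_iff.1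
      (Metric.tendsto_nhds.1 (hlim s) (ε / 2) (half_pos hε))
    filter_upwards [hq] with s' hs'
    -- With `s'` fixed near `s`, letting `r → ∞` passes the bound on `G r s'` to `h s'`.
    have h0 : Tendsto (fun r : ℝ => (r, s')) atTop (atTop ×ˢ 𝓝 s') :=
      tendsto_id.prodMk tendsto_const_nhds
    have h1 : Tendsto (fun r => G r s') atTop (𝓝 (h s')) := (hlim s').comp h0
    refine (le_of_tendsto (h1.dist tendsto_const_nhds) ?_).trans_lt (half_lt_self hε)
    filter_upwards [hp] with r hr
    exact (hpq hr hs').le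
  refine ⟨hcont, ?_⟩
  rw [← tendstoLocallyUniformly_iff_tendstoUniformly_of_compactSpace,
    tendstoLocallyUniformly_iff_forall_tendsto]
  intro s
  refine Tendsto.mono_right ?_ (nhds_le_uniformity (h s))
  rw [nhds_prod_eq]
  exact ((hcont.tendsto s).comp tendsto_snd).prodMk (hlim s)

/-- Expectations of functionals of rescaled paths converge as the scale tends to infinity,
uniformly over starting points on the unit sphere, and the limit is continuous there. -/
theorem tendstoUniformly_integral_pathVec (hα : ∀ i, 0 < α i)
    {Φ : (Fin d → ℝ) × E → Fin d → ℝ} (hΦ : Measurable Φ)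
    {ρ : Measure E} [IsProbabilityMeasure ρ] {φ : Sphere α × E → Fin d → ℝ}
    (hVS : VSCondition α Φ ρ φ) {t : ℕ} (f : (Fin (t + 1) → Fin d → ℝ) →ᵇ ℝ) :
    Continuous (fun s : Sphere α =>
        ∫ z, f (pathVec (extend hα φ) t s.1 z) ∂Measure.infinitePi fun _ : ℕ => ρ) ∧
      TendstoUniformly
        (fun r (s : Sphere α) =>
          ∫ z, f (pathVec (rescale α Φ r) t s.1 z) ∂Measure.infinitePi fun _ : ℕ => ρ)
        (fun s : Sphere α =>
          ∫ z, f (pathVec (extend hα φ) t s.1 z) ∂Measure.infinitePi fun _ : ℕ => ρ) atTop := by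
  set G : ℝ → Sphere α → ℝ := fun r s =>
    ∫ z, f (pathVec (rescale α Φ r) t s.1 z) ∂Measure.infinitePi fun _ : ℕ => ρ
  set h : Sphere α → ℝ := fun s =>
    ∫ z, f (pathVec (extend hα φ) t s.1 z) ∂Measure.infinitePi fun _ : ℕ => ρ
  have hlim : ∀ s : Sphere α,
      Tendsto (fun p : ℝ × Sphere α => G p.1 p.2) (atTop ×ˢ 𝓝 s) (𝓝 (h s)) := by
    intro s
    have hs : s.1 ≠ 0 := ne_zero_of_anorm_pos hα (s.2.symm ▸ one_pos)
    have hm : ∀ p : ℝ × Sphere α, AEStronglyMeasurable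
        (fun z => f (pathVec (rescale α Φ p.1) t p.2.1 z)) (Measure.infinitePi fun _ : ℕ => ρ) := by
      intro p
      have h1 := measurable_comp_pathVec (measurable_rescale hΦ hα p.1) f
      have h2 : Measurable fun z : ℕ → E => (p.2.1, z) := measurable_const.prodMk measurable_id
      exact (h1.comp h2).aestronglyMeasurable
    have hae : ∀ᵐ z ∂Measure.infinitePi fun _ : ℕ => ρ,
        Tendsto (fun p : ℝ × Sphere α => f (pathVec (rescale α Φ p.1) t p.2.1 z))
          (atTop ×ˢ 𝓝 s) (𝓝 (f (pathVec (extend hα φ) t s.1 z))) := by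
      filter_upwards [ae_path_ne_zero_or_linearGrowth hα hVS hs] with z hz
      have h1 : Tendsto (fun p : ℝ × Sphere α => (p.1, p.2.1)) (atTop ×ˢ 𝓝 s)
          (atTop ×ˢ 𝓝 s.1) :=
        tendsto_fst.prodMk ((continuous_subtype_val.tendsto s).comp tendsto_snd)
      have h2 : Tendsto (fun p : ℝ × (Fin d → ℝ) => pathVec (rescale α Φ p.1) t p.2 z)
          (atTop ×ˢ 𝓝 s.1) (𝓝 (pathVec (extend hα φ) t s.1 z)) :=
        tendsto_pi_nhds.2 fun k => tendsto_path_rescale hα hVS hz k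
      exact (f.continuous.tendsto _).comp (h2.comp h1)
    -- The joint filter is countably generated, so dominated convergence applies to it directly.
    exact tendsto_integral_filter_of_dominated_convergence (fun _ => ‖f‖) (.of_forall hm)
      (.of_forall fun p => .of_forall fun z => f.norm_coe_le_norm _) (integrable_const _) hae
  have := compactSpace_sphere hα
  exact continuous_and_tendstoUniformly_of_tendsto_prod hlim

end Limit

/-! ### Driven chains -/

section Chain

variable {d : ℕ} {α : Fin d → ℝ} {E : Type*} [MeasurableSpace E]
  {Ω : Type*} [MeasurableSpace Ω] {F : (Fin d → ℝ) → E → Fin d → ℝ} {ρ : Measure E}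
  {μ : Measure Ω} {Y : ℕ → Ω → Fin d → ℝ} {Z : ℕ → Ω → E}

theorem IsDrivenChain.isProbabilityMeasure_innov [IsProbabilityMeasure μ]
    (h : IsDrivenChain F ρ μ Y Z) : IsProbabilityMeasure ρ :=
  h.law_innov 0 ▸ Measure.isProbabilityMeasure_map (h.measurable_innov 0).aemeasurable

theorem IsDrivenChain.measurable_innov_seq (h : IsDrivenChain F ρ μ Y Z) :
    Measurable fun ω t => Z (t + 1) ω :=
  measurable_pi_lambda _ h.measurable_innov

theorem IsDrivenChain.map_innov_seq [IsProbabilityMeasure μ] (h : IsDrivenChain F ρ μ Y Z) :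
    μ.map (fun ω t => Z (t + 1) ω) = Measure.infinitePi fun _ => ρ := by
  rw [h.indep_innov.map_fun_eq_infinitePi_map h.measurable_innov]
  simp_rw [h.law_innov]

theorem IsDrivenChain.ae_eq_path (h : IsDrivenChain F ρ μ Y Z) :
    ∀ᵐ ω ∂μ, ∀ k, Y k ω = path F (Y 0 ω) (fun t => Z (t + 1) ω) k := by
  filter_upwards [ae_all_iff.2 h.recursion] with ω hω k
  induction k with
  | zero => rfl
  | succ k ih => rw [hω k, ih, path]

theorem IsDrivenChain.integral_cond [IsProbabilityMeasure μ] (h : IsDrivenChain F ρ μ Y Z)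
    {B : Set (Fin d → ℝ)} (hB : MeasurableSet B) {H : (Fin d → ℝ) × (ℕ → E) → ℝ}
    (hH : Measurable H) {C : ℝ} (hC : ∀ p, |H p| ≤ C) :
    ∫ ω, H (Y 0 ω, fun t => Z (t + 1) ω) ∂(μ[|Y 0 ⁻¹' B])
      = ∫ ω, (∫ z, H (Y 0 ω, z) ∂Measure.infinitePi fun _ => ρ) ∂(μ[|Y 0 ⁻¹' B]) := by
  rw [integral_cond_of_indepFun (h.measurable_state 0) h.measurable_innov_seq
    h.indep_initial hB hH hC, h.map_innov_seq]

theorem IsDrivenChain.integral_pathVec [IsProbabilityMeasure μ] (h : IsDrivenChain F ρ μ Y Z)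
    (hF : Measurable fun p : (Fin d → ℝ) × E => F p.1 p.2) {t : ℕ}
    (f : (Fin (t + 1) → Fin d → ℝ) →ᵇ ℝ) :
    ∫ y, f y ∂(μ.map fun ω (k : Fin (t + 1)) => Y k ω)
      = ∫ ω, (∫ z, f (pathVec F t (Y 0 ω) z) ∂Measure.infinitePi fun _ => ρ) ∂μ := by
  have h1 := h.integral_cond MeasurableSet.univ (measurable_comp_pathVec hF f)
    (fun p => f.norm_coe_le_norm _)
  rw [Set.preimage_univ, cond_univ] at h1
  have h2 : Measurable fun ω (k : Fin (t + 1)) => Y k ω :=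
    measurable_pi_lambda _ fun k => h.measurable_state k
  rw [← h1, integral_map h2.aemeasurable f.continuous.measurable.aestronglyMeasurable]
  refine integral_congr_ae ?_
  filter_upwards [h.ae_eq_path] with ω hω
  congr 1
  ext1 k
  exact hω k

end Chain

/-! ### The theorem -/

section Main

variable {d : ℕ} {α : Fin d → ℝ} {Ω : Type*} [MeasurableSpace Ω]

theorem measurable_scaleDown_anorm (hα : ∀ i, 0 < α i) {V W : Ω → Fin d → ℝ}
    (hV : Measurable V) (hW : Measurable W) :
    Measurable fun ω => scaleDown α (anorm α (V ω)) (W ω) :=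
  measurable_scaleDown.comp (((continuous_anorm hα).measurable.comp hV).prodMk hW)

/-- A weak limit of the conditional spectral laws is carried by the unit sphere. -/
theorem ae_anorm_eq_one_of_tendstoWeakly (hα : ∀ i, 0 < α i) {μ : Measure Ω} {V : Ω → Fin d → ℝ}
    (hV : Measurable V) {ν : Measure (Fin d → ℝ)} [IsFiniteMeasure ν]
    (h : TendstoWeakly (condSpectralLaw α μ V) ν) : ∀ᵐ y ∂ν, anorm α y = 1 := by
  -- A bounded continuous test function that vanishes exactly on the sphere.
  have hcont : Continuous fun y : Fin d → ℝ => min |anorm α y - 1| 1 :=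
    ((continuous_anorm hα).sub continuous_const).abs.min continuous_const
  have hb : ∀ y : Fin d → ℝ, ‖min |anorm α y - 1| 1‖ ≤ 1 := fun y => by
    rw [Real.norm_of_nonneg (le_min (abs_nonneg _) zero_le_one)]
    exact min_le_right _ _
  let g : (Fin d → ℝ) →ᵇ ℝ := .ofNormedAddCommGroup _ hcont 1 hb
  have hg : ∀ y, g y = min |anorm α y - 1| 1 := fun _ => rfl
  have ha := (continuous_anorm hα).measurable
  have hzero : ∀ x : ℝ, 0 ≤ x → ∫ y, g y ∂(condSpectralLaw α μ V x) = 0 := by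
    intro x hx
    rw [condSpectralLaw, integral_map (measurable_scaleDown_anorm hα hV hV).aemeasurable
      g.continuous.measurable.aestronglyMeasurable]
    refine integral_eq_zero_of_ae ?_
    filter_upwards [ae_cond_mem (measurableSet_lt measurable_const (ha.comp hV))] with ω hω
    have hω' : x < anorm α (V ω) := hω
    simp [hg, anorm_scaleDown hα (ne_zero_of_anorm_pos hα (hx.trans_lt hω'))]
  have hint : ∫ y, g y ∂ν = 0 :=
    tendsto_nhds_unique (h g) (tendsto_const_nhds.congr' (by
      filter_upwards [eventually_ge_atTop 0] with x hx using (hzero x hx).symm))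
  have hae := (integral_eq_zero_iff_of_nonneg
    (fun y => (le_min (abs_nonneg _) zero_le_one : (0 : ℝ) ≤ min |anorm α y - 1| 1))
    (g.integrable ν)).1 hint
  filter_upwards [hae] with y hy
  have hy' : min |anorm α y - 1| 1 = 0 := hy
  rcases min_choice |anorm α y - 1| 1 with h1 | h1
  · exact sub_eq_zero.1 (abs_eq_zero.1 (h1 ▸ hy'))
  · exact absurd (h1 ▸ hy') one_ne_zero

variable {E : Type*} [MeasurableSpace E] {μ : Measure Ω} [IsProbabilityMeasure μ]
  {Φ : (Fin d → ℝ) × E → Fin d → ℝ} {ρ : Measure E} {X : ℕ → Ω → Fin d → ℝ} {Z : ℕ → Ω → E}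
  {φ : Sphere α × E → Fin d → ℝ}

/-- The mean of a functional of the path from `v`, scaled by `‖v‖_α`. -/
def meanScaledPath (α : Fin d → ℝ) (Φ : (Fin d → ℝ) × E → Fin d → ℝ) (ρ : Measure E) {t : ℕ}
    (f : (Fin (t + 1) → Fin d → ℝ) →ᵇ ℝ) (v : Fin d → ℝ) : ℝ :=
  ∫ z, f (fun k => scaleDown α (anorm α v) (pathVec (fun y e => Φ (y, e)) t v z k))
    ∂Measure.infinitePi fun _ : ℕ => ρ

theorem measurable_scaled_pathVec (hα : ∀ i, 0 < α i) (hΦ : Measurable Φ) {t : ℕ}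
    (f : (Fin (t + 1) → Fin d → ℝ) →ᵇ ℝ) :
    Measurable fun p : (Fin d → ℝ) × (ℕ → E) => f fun k =>
      scaleDown α (anorm α p.1) (pathVec (fun y e => Φ (y, e)) t p.1 p.2 k) :=
  f.continuous.measurable.comp (measurable_pi_lambda _ fun k =>
    measurable_scaleDown_anorm hα measurable_fst
      (measurable_path (F := fun y e => Φ (y, e)) hΦ k))

theorem meanScaledPath_eq (Φ : (Fin d → ℝ) × E → Fin d → ℝ) (ρ : Measure E) {t : ℕ}
    (f : (Fin (t + 1) → Fin d → ℝ) →ᵇ ℝ) {v : Fin d → ℝ} (hv : 0 < anorm α v) :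
    meanScaledPath α Φ ρ f v = ∫ z, f (pathVec (rescale α Φ (anorm α v)) t
      (scaleDown α (anorm α v) v) z) ∂Measure.infinitePi fun _ : ℕ => ρ := by
  refine integral_congr_ae (.of_forall fun z => ?_)
  have : (fun k => scaleDown α (anorm α v) (pathVec (fun y e => Φ (y, e)) t v z k))
      = pathVec (rescale α Φ (anorm α v)) t (scaleDown α (anorm α v) v) z :=
    funext fun k => scaleDown_path hv v z k
  exact congrArg f this

/-- Both the event and the normalization depend on `X 0` alone, so the innovations integrate out
under the conditioning. -/
theorem integral_condPathLaw (hα : ∀ i, 0 < α i) (hΦ : Measurable Φ)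
    (hchain : IsDrivenChain (fun v e => Φ (v, e)) ρ μ X Z) {t : ℕ}
    (f : (Fin (t + 1) → Fin d → ℝ) →ᵇ ℝ) (x : ℝ) :
    ∫ y, f y ∂(condPathLaw α μ X t x)
      = ∫ ω, meanScaledPath α Φ ρ f (X 0 ω) ∂(μ[|{ω | x < anorm α (X 0 ω)}]) := by
  have hX := hchain.measurable_state
  have hB : MeasurableSet {v : Fin d → ℝ | x < anorm α v} :=
    measurableSet_lt measurable_const (continuous_anorm hα).measurable
  have hm : Measurable fun ω (k : Fin (t + 1)) => scaleDown α (anorm α (X 0 ω)) (X k ω) :=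
    measurable_pi_lambda _ fun k => measurable_scaleDown_anorm hα (hX 0) (hX k)
  have hpath : ∀ᵐ ω ∂(μ[|{ω | x < anorm α (X 0 ω)}]), ∀ k, X k ω
      = path (fun v e => Φ (v, e)) (X 0 ω) (fun t => Z (t + 1) ω) k :=
    cond_absolutelyContinuous.ae_le hchain.ae_eq_path
  have h1 := hchain.integral_cond hB (measurable_scaled_pathVec hα hΦ f)
    fun p => f.norm_coe_le_norm _
  rw [condPathLaw, integral_map hm.aemeasurable f.continuous.measurable.aestronglyMeasurable]
  refine Eq.trans (integral_congr_ae ?_) h1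
  filter_upwards [hpath] with ω hω
  simp only [pathVec, ← hω]

theorem isSpectralTailProcess_of_isDrivenChain (hα : ∀ i, 0 < α i) (hΦ : Measurable Φ)
    (hchain : IsDrivenChain (fun v e => Φ (v, e)) ρ μ X Z) (hVS : VSCondition α Φ ρ φ)
    {Ω' : Type*} [MeasurableSpace Ω'] {μ' : Measure Ω'} [IsProbabilityMeasure μ']
    {Θ : ℕ → Ω' → Fin d → ℝ} {Z' : ℕ → Ω' → E}
    (hΘ : IsDrivenChain (extend hα φ) ρ μ' Θ Z') (h₀ : IsSpectralComponent α μ (X 0) μ' (Θ 0)) :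
    IsSpectralTailProcess α μ X μ' Θ := by
  refine ⟨hΘ.measurable_state, fun t f => ?_⟩
  have := hchain.isProbabilityMeasure_innov
  have ha := (continuous_anorm hα).measurable
  have hX0 := hchain.measurable_state 0
  obtain ⟨hcont, hunif⟩ := tendstoUniformly_integral_pathVec hα hΦ hVS f
  set h : (Fin d → ℝ) → ℝ := fun v =>
    ∫ z, f (pathVec (extend hα φ) t v z) ∂Measure.infinitePi fun _ : ℕ => ρ with hh
  have : CompactSpace {v : Fin d → ℝ | anorm α v = 1} := compactSpace_sphere hα
  -- Continuity of `h` is known only on the sphere, whereas weak convergence is tested on all of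
  -- `ℝ^d`: Tietze extension supplies a test function `g`.
  obtain ⟨g, -, hg⟩ := exists_norm_eq_domRestrict_eq_of_closed
    (s := {v : Fin d → ℝ | anorm α v = 1})
    (BoundedContinuousFunction.mkOfCompact ⟨fun s : Sphere α => h s.1, hcont⟩)
    (isClosed_eq (continuous_anorm hα) continuous_const)
  have hgs : ∀ v : Fin d → ℝ, anorm α v = 1 → g v = h v := fun v hv =>
    DFunLike.congr_fun hg ⟨v, hv⟩
  have hlim : ∫ y, f y ∂(μ'.map fun ω (k : Fin (t + 1)) => Θ k ω) = ∫ y, g y ∂(μ'.map (Θ 0)) := by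
    have := Measure.isProbabilityMeasure_map (μ := μ') h₀.1.aemeasurable
    -- Since `Θ 0` almost surely lies on the sphere, the values of `g` elsewhere play no role.
    have hae := ae_of_ae_map h₀.1.aemeasurable (ae_anorm_eq_one_of_tendstoWeakly hα hX0 h₀.2)
    rw [hΘ.integral_pathVec (measurable_extend hα hVS.measurable_limit), integral_map
      h₀.1.aemeasurable g.continuous.measurable.aestronglyMeasurable]
    refine integral_congr_ae ?_
    filter_upwards [hae] with ω hω
    exact (hgs _ hω).symm
  rw [hlim]
  refine (h₀.2 g).congr_dist (Metric.tendsto_nhds.2 fun ε hε => ?_)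
  obtain ⟨K, hK⟩ := eventually_atTop.1 (Metric.tendstoUniformly_iff.1 hunif (ε / 2) (half_pos hε))
  -- On the event the radius exceeds `K`, so the uniform bound applies at the random scale `‖X₀‖_α`;
  -- the `0` ensures that `X₀ ≠ 0` there.
  filter_upwards [eventually_ge_atTop (max K 0)] with x hx
  have hx0 := (le_max_right _ _).trans hx
  have hbound : ∀ᵐ ω ∂(μ[|{ω | x < anorm α (X 0 ω)}]),
      ‖g (scaleDown α (anorm α (X 0 ω)) (X 0 ω)) - meanScaledPath α Φ ρ f (X 0 ω)‖ ≤ ε / 2 := by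
    filter_upwards [ae_cond_mem (measurableSet_lt measurable_const (ha.comp hX0))] with ω hω
    have hω' : x < anorm α (X 0 ω) := hω
    have hpos := hx0.trans_lt hω'
    have hne := ne_zero_of_anorm_pos hα hpos
    rw [hgs _ (anorm_scaleDown hα hne), meanScaledPath_eq Φ ρ f hpos, ← dist_eq_norm]
    exact (hK _ (((le_max_left _ _).trans hx).trans hω'.le) (direction hα ⟨_, hne⟩)).le
  have hS : Measurable fun ω => scaleDown α (anorm α (X 0 ω)) (X 0 ω) :=
    measurable_scaleDown_anorm hα hX0 hX0
  have hint1 : Integrable (fun ω => g (scaleDown α (anorm α (X 0 ω)) (X 0 ω)))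
      (μ[|{ω | x < anorm α (X 0 ω)}]) :=
    .of_bound (g.continuous.measurable.comp hS).aestronglyMeasurable ‖g‖
      (.of_forall fun ω => g.norm_coe_le_norm _)
  have hint2 : Integrable (fun ω => meanScaledPath α Φ ρ f (X 0 ω))
      (μ[|{ω | x < anorm α (X 0 ω)}]) := by
    refine .of_bound (C := ‖f‖) ?_ (.of_forall fun ω => ?_)
    · have h1 : StronglyMeasurable (meanScaledPath α Φ ρ f) :=
        (measurable_scaled_pathVec hα hΦ f).stronglyMeasurable.integral_prod_right'
      exact (h1.comp_measurable hX0).aestronglyMeasurable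
    · refine (norm_integral_le_of_norm_le_const
        (.of_forall fun z => f.norm_coe_le_norm _)).trans_eq ?_
      rw [probReal_univ, mul_one]
  rw [dist_zero_right, Real.norm_of_nonneg dist_nonneg, dist_eq_norm,
    integral_condPathLaw hα hΦ hchain f x, condSpectralLaw,
    integral_map hS.aemeasurable g.continuous.measurable.aestronglyMeasurable,
    ← integral_sub hint1 hint2]
  -- Total mass at most `1` is enough, which also covers a null event, where the conditional measure
  -- is `0`.
  calc _ ≤ ε / 2 * (μ[|{ω | x < anorm α (X 0 ω)}]).real Set.univ :=
        norm_integral_le_of_norm_le_const hbound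
    _ ≤ ε / 2 := mul_le_of_le_one_right (half_pos hε).le measureReal_le_one
    _ < ε := half_lt_self hε

/-- The canonical chain on the product of the initial law with the law of the innovations. -/
theorem isDrivenChain_path {F : (Fin d → ℝ) → E → Fin d → ℝ}
    (hF : Measurable fun p : (Fin d → ℝ) × E => F p.1 p.2) (ν : Measure (Fin d → ℝ))
    [IsProbabilityMeasure ν] (ρ : Measure E) [IsProbabilityMeasure ρ] :
    IsDrivenChain F ρ (ν.prod (Measure.infinitePi fun _ : ℕ => ρ))
      (fun t ω => path F ω.1 ω.2 t) (fun t ω => ω.2 (t - 1)) := by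
  -- With the shift `t - 1`, the innovation at time `t + 1` is coordinate `t`; the value at time `0`
  -- is a harmless duplicate.
  have hlaw : ∀ t : ℕ, (ν.prod (Measure.infinitePi fun _ : ℕ => ρ)).map
      (fun ω => ω.2 t) = ρ := by
    intro t
    have h := Measure.map_map (μ := ν.prod (Measure.infinitePi fun _ : ℕ => ρ))
      (measurable_pi_apply (X := fun _ : ℕ => E) t) measurable_snd
    rw [← Measure.snd, Measure.snd_prod, Measure.infinitePi_map_eval] at h
    exact h.symm
  refine ⟨measurable_path hF, fun t => (measurable_pi_apply t).comp measurable_snd, hlaw, ?_,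
    indepFun_prod measurable_id measurable_id, fun _ => .of_forall fun _ => rfl⟩
  rw [iIndepFun_iff_map_fun_eq_infinitePi_map (X := fun t (ω : (Fin d → ℝ) × (ℕ → E)) =>
    ω.2 (t + 1 - 1)) fun t => (measurable_pi_apply t).comp measurable_snd]
  simp only [Nat.add_sub_cancel, hlaw]
  exact Measure.snd_prod

end Main

end VSRV

end

/-- Let `X_t = Φ(X_{t-1}, Z_t)` be a Markov chain with `Φ` satisfying the vector-scaling condition
and `X₀` VSRV. Then `(X_t)` is VSRV, it has a spectral tail process with
`Θ_t = φ(Θ_{t-1}, Z_t)`, and every process that satisfies this recursion and starts from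
the spectral component of `X₀` is a spectral tail process of `(X_t)`. -/
theorem mainTheorem7 {d : ℕ} (α : Fin d → ℝ) (hα : ∀ i, 0 < α i)
    {E : Type v} [TopologicalSpace E] [PolishSpace E] [MeasurableSpace E] [BorelSpace E]
    {Ω : Type u} [MeasurableSpace Ω] (μ : Measure Ω) [IsProbabilityMeasure μ]
    (Φ : (Fin d → ℝ) × E → Fin d → ℝ) (hΦ : Measurable Φ)
    (ρ : Measure E) (X : ℕ → Ω → Fin d → ℝ) (Z : ℕ → Ω → E)
    (hchain : VSRV.IsDrivenChain (fun v e => Φ (v, e)) ρ μ X Z)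
    (φ : VSRV.Sphere α × E → Fin d → ℝ) (hVS : VSRV.VSCondition α Φ ρ φ)
    (hX₀ : VSRV.IsVSRVVector α μ (X 0)) :
    VSRV.IsVSRV α μ X ∧
    (∃ (Ω' : Type v) (_ : MeasurableSpace Ω') (μ' : Measure Ω')
      (Θ : ℕ → Ω' → Fin d → ℝ) (Z' : ℕ → Ω' → E),
        IsProbabilityMeasure μ' ∧
        VSRV.IsDrivenChain (VSRV.extend hα φ) ρ μ' Θ Z' ∧
        VSRV.IsSpectralComponent α μ (X 0) μ' (Θ 0) ∧
        VSRV.IsSpectralTailProcess α μ X μ' Θ) ∧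
    (∀ (Ω' : Type w) (_ : MeasurableSpace Ω') (μ' : Measure Ω')
      (Θ : ℕ → Ω' → Fin d → ℝ) (Z' : ℕ → Ω' → E),
        IsProbabilityMeasure μ' →
        VSRV.IsDrivenChain (VSRV.extend hα φ) ρ μ' Θ Z' →
        VSRV.IsSpectralComponent α μ (X 0) μ' (Θ 0) →
        VSRV.IsSpectralTailProcess α μ X μ' Θ) := by
  obtain ⟨ν, hν, hlim⟩ := hX₀.exists_limit
  have := hchain.isProbabilityMeasure_innov
  have hΘ := VSRV.isDrivenChain_path (VSRV.measurable_extend hα hVS.measurable_limit) ν ρ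
  have h₀ : VSRV.IsSpectralComponent α μ (X 0) (ν.prod (Measure.infinitePi fun _ : ℕ => ρ))
      (fun ω => VSRV.path (VSRV.extend hα φ) ω.1 ω.2 0) := by
    refine ⟨measurable_fst, ?_⟩
    have hmap : (ν.prod (Measure.infinitePi fun _ : ℕ => ρ)).map
        (fun ω => VSRV.path (VSRV.extend hα φ) ω.1 ω.2 0) = ν := Measure.fst_prod
    rwa [hmap]
  have htail := VSRV.isSpectralTailProcess_of_isDrivenChain hα hΦ hchain hVS hΘ h₀
  -- The limit laws required for VSRV are the finite-dimensional laws of the canonical chain started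
  -- from `ν`.
  refine ⟨⟨hX₀.tails, fun t => ⟨_, ?_, htail.2 t⟩⟩,
    ⟨_, _, _, _, _, inferInstance, hΘ, h₀, htail⟩, ?_⟩
  · refine Measure.isProbabilityMeasure_map (Measurable.aemeasurable ?_)
    exact measurable_pi_lambda _ fun k => htail.1 k
  · intro Ω' _ μ' Θ Z' _ hΘ' h₀'
    exact VSRV.isSpectralTailProcess_of_isDrivenChain hα hΦ hchain hVS hΘ' h₀'
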